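/- **Setting.** Let $\mathcal A$ be a finite alphabet, $D\ge 1$, and give $\mathcal A^{\mathbb Z^D}$ the product topology, with shifts $\sigma^v(a)_z=a_{z+v}$. Let $\Phi:\mathcal A^{\mathbb Z^D}\to\mathcal A^{\mathbb Z^D}$ be a cellular automaton (continuous, commuting with all shifts) and $\mathfrak A\subseteq\mathcal A^{\mathbb Z^D}$ a subshift (closed, shift-invariant) with $\Phi(\mathfrak A)=\mathfrak A$. *Geometry.* $B(z,r)=z+[-r,r]^D$; $Y(r)=\{y\in Y: B(y,r)\subseteq Y\}$. Two points of $\mathbb Z^D$ are adjacent if their sup-distance is $1$; connectedness of subsets of $\mathbb Z^D$ is through trails of adjacent points. $Y\subseteq\mathbb Z^D$ is *spacious* if it is connected and $Y(r)\ne\emptyset$ for all $r$. $\mathfrak A$ is *projectively transitive* if for every spacious $Y$ and nonempty open $O\subseteq\mathfrak A$, $\bigcup_{y\in Y}\sigma^{-y}(O)$ is dense in $\mathfrak A$; assume this. *Defects.* For a configuration $a$, $\mathcal E_a(z)\in\mathbb N\cup\{\infty\}$ is the largest $r$ such that $a_{B(z,r)}$ occurs in $\mathfrak A$; $G_r(a)=\{z:\mathcal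 E_a(z)\ge r\}$; $\widetilde{\mathfrak A}=\{a:\sup_z\mathcal E_a(z)=\infty\}$. A connected component $C$ of $G_r(a)$ is *projective* if $C\cap G_R(a)\ne\emptyset$ for all $R\ge r$; $a$ has a *projective domain boundary* if some $G_R(a)$ has at least two projective components. *Spectrum.* "A.e." means on a comeager subset of $\mathfrak A$. An a.e. eigenfunction with eigenvalue $\lambda=(\lambda_0;\lambda_1,\dots,\lambda_D)\in\mathbb T^{D+1}$ is a bounded $f:\mathfrak A\to\mathbb C$, not a.e. zero, continuous at each point of a comeager set, with $f\circ\Phi=\lambda_0f$ a.e. and $f\circ\sigma^z=\lambda^zf$ a.e. for all $z\in\mathbb Z^D$, where $\lambda^z=\prod_{i=1}^D\lambda_i^{z_i}$. Let $\mathcal S_{ae}$ be the set of their eigenvalues, and fix an *eigenset* $F=\{f_\lambda\}_{\lambda\in\mathcal S_{ae}}$, one a.e. eigenfunction for each $\lambda$. The rational spectrum $\mathcal S_{rat}$ is the set of eigenvalues of nonzero *continuous* eigenfunctions (equations holding everywhere on $\mathfrak A$) all of whose coordinates are roots of unity. *Good configurations.* The regular set $\underline{\mathfrak A}$ consists of the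 $a\in\mathfrak A$ with $f_\lambda(\Phi^n\sigma^za)=\lambda_0^n\lambda^zf_\lambda(a)$ for all $\lambda\in\mathcal S_{ae}$, $n\in\mathbb N$, $z\in\mathbb Z^D$. For spacious $Y$, $\widehat{\mathfrak A}(Y)$ is the set of $a\in\underline{\mathfrak A}$ such that for all $\lambda\in\mathcal S_{ae}$, $k\in\mathbb N$, $\varepsilon>0$, $n$, $z$, the point $a'=\Phi^n\sigma^za$ has a box $B(y,r)\subseteq Y(k)$ such that $|f_\lambda(\sigma^yb)-f_\lambda(\sigma^ya')|<\varepsilon$ for every $b\in\mathfrak A$ with $b_{B(y,r)}=a'_{B(y,r)}$. For disjoint spacious $Y_1,\dots,Y_N$, $\widehat{\mathfrak A}(Y_1,\dots,Y_N)$ is the set of $a\in\widetilde{\mathfrak A}$ such that for every $r>0$ and every projective component $C$ of $G_r(a)$, $a_C$ extends to a point of $\underline{\mathfrak A}$, and for every $n$, $a_{Y_n}$ extends to a point of $\widehat{\mathfrak A}(Y_n)$. **Theorem.** Let $Y_1,\dots,Y_N\subseteq\mathbb Z^D$ be disjoint and spacious and let $a\in\widehat{\mathfrak A}(Y_1,\dots,Y_N)$.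 For each $n$ and $\lambda\in\mathcal S_{ae}$, $f_\lambda$ takes one and the same nonzero value, denoted $f_\lambda(a_{Y_n})$, at all points of $\underline{\mathfrak A}$ extending $a_{Y_n}$. Put $\delta_{nm}(\lambda)=f_\lambda(a_{Y_n})/f_\lambda(a_{Y_m})$. Then: (a) $\delta_{nm}(\lambda)$ is independent of the choice of eigenfunctions: any other eigenset $F'$ for which $a$ lies in the corresponding set $\widehat{\mathfrak A}'(Y_1,\dots,Y_N)$ gives the same $\delta_{nm}(\lambda)$. (b) $\mathcal S_{ae}$ is a subgroup of $\mathbb T^{D+1}$ and $\delta_{nm}:\mathcal S_{ae}\to\mathbb T$ is a group homomorphism. (c) $\delta_{n\ell}(\lambda)=\delta_{nm}(\lambda)\,\delta_{m\ell}(\lambda)$ for all $n,m,\ell$ and $\lambda\in\mathcal S_{ae}$. (d) If $\delta_{nm}\not\equiv1$, then $a$ has a projective domain boundary between $Y_n$ and $Y_m$, in this sense: $a\notin\mathfrak A$; for all $r>0$ and $R\ge0$, no projective component of $G_r(a)$ contains both $Y_n(R)$ and $Y_m(R)$ (in particular none contains both $Y_n$ and $Y_m$); and if each of $Y_n$, $Y_m$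 lies, up to a margin, in a projective component (that is, $Y_n(R)\subseteq C$ for some $R\ge 0$, $r>0$ and projective component $C$ of $G_r(a)$, and likewise for $Y_m$), then $a$ has a projective domain boundary, and for some $r>0$ and $R\ge 0$ the sets $Y_n(R)$ and $Y_m(R)$ are contained in two different projective components of $G_r(a)$. A set $Y_n$ lies in a projective component up to a margin whenever $Y_n(R)$ is connected for some $R>0$. (e) Let $\lambda\in\mathcal S_{rat}$. Then $\lambda\in\mathcal S_{ae}$. Let $g$ be a nonzero continuous eigenfunction for $\lambda$. Then $g(b)$ depends only on $b_{B(0,r')}$ for some $r'\in\mathbb N$. For any such $r'$ write $g_z(a)$ for the value of $g$ on the block $a_{B(z,r')}$ if this block occurs in $\mathfrak A$, and $\gamma_{y,z}(\lambda)=\lambda^{y-z}g_z(a)/g_y(a)$. Then $\gamma_{z,y}(\lambda)=\delta_{nm}(\lambda)$ for all $y\in Y_n(r')$, $z\in Y_m(r')$. Moreover, for every $r\ge r'+1$ and connected components $C,C'$ of $G_r(a)$ that meet $Y_n(r')$ and $Y_m(r')$ respectively, $\gamma_{z,y}(\lambda)=\delta_{nm}(\lambda)$ for all $y\in C$, $z\in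 C'$; so $\delta_{nm}(\lambda)$ is the displacement that the phase gaps $\gamma$ define between the components. -/

import Mathlib

open Set Filter Topology

noncomputable section

namespace CADefect

variable {A : Type*} {D : ℕ}

/-- Configurations `a = (a_z)_{z ∈ ℤ^D}` over the alphabet `A`; the topology is the product topology
(the Cantor topology when `A` is finite and discrete). -/
abbrev Config (A : Type*) (D : ℕ) : Type _ := (Fin D → ℤ) → A

/-- The shift `σ^v(a)_z = a_{z+v}`. -/
def shift (v : Fin D → ℤ) (a : Config A D) : Config A D := fun z => a (z + v)

/-- Cellular automata: continuous maps that commute with all shifts. -/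
def IsCA [TopologicalSpace A] (Φ : Config A D → Config A D) : Prop :=
  Continuous Φ ∧ ∀ v a, Φ (shift v a) = shift v (Φ a)

/-- Subshifts: closed, shift-invariant sets of configurations. -/
def IsSubshift [TopologicalSpace A] (𝔄 : Set (Config A D)) : Prop :=
  IsClosed 𝔄 ∧ ∀ v : Fin D → ℤ, shift v '' 𝔄 = 𝔄

/-! ### Geometry of the lattice -/

/-- The box `B(z,r) = z + [-r,r]^D`, i.e. the ball of radius `r` for the sup norm. -/
def box (z : Fin D → ℤ) (r : ℕ) : Set (Fin D → ℤ) := {y | ∀ i, |y i - z i| ≤ (r : ℤ)}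

/-- The `r`-interior `Y(r) = {y ∈ Y : B(y,r) ⊆ Y}`. -/
def core (Y : Set (Fin D → ℤ)) (r : ℕ) : Set (Fin D → ℤ) := {y | y ∈ Y ∧ box y r ⊆ Y}

/-- Adjacency: sup-norm distance exactly one. -/
def Adj (y z : Fin D → ℤ) : Prop := y ≠ z ∧ z ∈ box y 1

/-- There is a trail inside `Y` from `x` to `y`. -/
def TrailIn (Y : Set (Fin D → ℤ)) (x y : Fin D → ℤ) : Prop :=
  x ∈ Y ∧ Relation.ReflTransGen (fun u v => Adj u v ∧ v ∈ Y) x y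

def TrailConnected (Y : Set (Fin D → ℤ)) : Prop := ∀ x ∈ Y, ∀ y ∈ Y, TrailIn Y x y

/-- `C` is a (trail-)connected component of `U`. -/
def IsTrailComponent (U C : Set (Fin D → ℤ)) : Prop := ∃ x ∈ U, C = {y | TrailIn U x y}

/-- Spacious sets: trail-connected and containing arbitrarily large boxes. -/
def Spacious (Y : Set (Fin D → ℤ)) : Prop := TrailConnected Y ∧ ∀ r : ℕ, (core Y r).Nonempty

/-- Projective transitivity: for every spacious `Y` and every nonempty relatively open
`O = 𝔄 ∩ U`, the union of the `σ^{-y}(O)`, `y ∈ Y`, is dense in `𝔄`. -/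
def ProjectivelyTransitive [TopologicalSpace A] (𝔄 : Set (Config A D)) : Prop :=
  ∀ Y : Set (Fin D → ℤ), Spacious Y → ∀ U : Set (Config A D), IsOpen U → (𝔄 ∩ U).Nonempty →
    𝔄 ⊆ closure (⋃ y ∈ Y, shift (-y) '' (𝔄 ∩ U))

/-! ### Defects -/

/-- The block `a_{B(z,r)}` is `𝔄`-admissible. (By shift invariance it does not matter whether one
compares with `𝔄_{B(z,r)}` or, after translation, with `𝔄_{B(0,r)}`.) -/
def Admissible (𝔄 : Set (Config A D)) (a : Config A D) (z : Fin D → ℤ) (r : ℕ) : Prop :=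
  ∃ b ∈ 𝔄, EqOn b a (box z r)

/-- The defect field: the largest `r` such that `a_{B(z,r)}` is admissible, possibly `∞`. -/
def defectField (𝔄 : Set (Config A D)) (a : Config A D) (z : Fin D → ℤ) : ℕ∞ :=
  ⨆ (r : ℕ) (_ : Admissible 𝔄 a z r), (r : ℕ∞)

/-- The set of slightly defective configurations. -/
def slightlyDefective (𝔄 : Set (Config A D)) : Set (Config A D) :=
  {a | (⨆ z, defectField 𝔄 a z) = ⊤}

/-- The set of points where the defect field is at least `R`. -/
def unflawed (𝔄 : Set (Config A D)) (a : Config A D) (R : ℕ) : Set (Fin D → ℤ) :=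
  {z | (R : ℕ∞) ≤ defectField 𝔄 a z}

/-- `C` is a projective component of the range-`r` unflawed set of `a`. -/
def IsProjectiveComponent (𝔄 : Set (Config A D)) (a : Config A D) (r : ℕ)
    (C : Set (Fin D → ℤ)) : Prop :=
  IsTrailComponent (unflawed 𝔄 a r) C ∧ ∀ R : ℕ, r ≤ R → (C ∩ unflawed 𝔄 a R).Nonempty

/-- `a` has a projective domain boundary: some unflawed set has two projective components. -/
def HasProjectiveDomainBoundary (𝔄 : Set (Config A D)) (a : Config A D) : Prop :=
  ∃ (R : ℕ) (C C' : Set (Fin D → ℤ)),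
    IsProjectiveComponent 𝔄 a R C ∧ IsProjectiveComponent 𝔄 a R C' ∧ C ≠ C'

/-- Up to a margin, `Y` lies in one projective component. (Only the `r`-interior of a set on which
`a` is admissible is certain to be contained in the range-`r` unflawed set, hence the margin.) -/
def LiesInProjectiveComponent (𝔄 : Set (Config A D)) (a : Config A D)
    (Y : Set (Fin D → ℤ)) : Prop :=
  ∃ r : ℕ, 0 < r ∧ ∃ (R : ℕ) (C : Set (Fin D → ℤ)), IsProjectiveComponent 𝔄 a r C ∧ core Y R ⊆ C

/-- `Y` and `Y'` lie, up to a margin, in two different projective components (of one range). -/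
def ProjectiveDomainBoundaryBetween (𝔄 : Set (Config A D)) (a : Config A D)
    (Y Y' : Set (Fin D → ℤ)) : Prop :=
  ∃ r : ℕ, 0 < r ∧ ∃ (R : ℕ) (C C' : Set (Fin D → ℤ)),
    IsProjectiveComponent 𝔄 a r C ∧ IsProjectiveComponent 𝔄 a r C' ∧ C ≠ C' ∧
      core Y R ⊆ C ∧ core Y' R ⊆ C'

/-! ### Eigenvalues and eigenfunctions

Functions on `𝔄` are represented by functions on all configurations; only their values on `𝔄` enter
the definitions (recall `Φ(𝔄) = 𝔄` and `σ^z(𝔄) = 𝔄`). -/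

/-- `𝕋^{D+1}`, with elements `(λ₀; λ₁, …, λ_D)`. -/
abbrev Torus (D : ℕ) : Type := Circle × (Fin D → Circle)

/-- `λ^z = λ₁^{z₁} ⋯ λ_D^{z_D}`. -/
def spacePow (l : Torus D) (z : Fin D → ℤ) : Circle := ∏ i, l.2 i ^ z i

/-- `f` is a nonzero continuous `(Φ,σ)`-eigenfunction on `𝔄` with eigenvalue `l`. -/
structure IsEigenfunction [TopologicalSpace A] (𝔄 : Set (Config A D))
    (Φ : Config A D → Config A D) (l : Torus D) (f : Config A D → ℂ) : Prop where
  continuousOn : ContinuousOn f 𝔄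
  ca_eq : ∀ a ∈ 𝔄, f (Φ a) = (l.1 : ℂ) * f a
  shift_eq : ∀ z, ∀ a ∈ 𝔄, f (shift z a) = (spacePow l z : ℂ) * f a
  ne_zero : ∃ a ∈ 𝔄, f a ≠ 0

/-- The rational spectrum: eigenvalues of continuous eigenfunctions all of whose coordinates are
roots of unity (equivalently, which have finite order in `𝕋^{D+1}`). -/
def ratSpec [TopologicalSpace A] (𝔄 : Set (Config A D)) (Φ : Config A D → Config A D) :
    Set (Torus D) :=
  {l | (∃ f, IsEigenfunction 𝔄 Φ l f) ∧ IsOfFinOrder l}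

/-- `f` is an a.e. `(Φ,σ)`-eigenfunction on `𝔄` with eigenvalue `l`: bounded, continuous at each
point of a comeager subset of `𝔄`, satisfying the eigenvalue equations off meager subsets of `𝔄`,
and not a.e. zero. Here `residual 𝔄` is the filter of comeager subsets of the space `𝔄`. -/
structure IsAEEigenfunction [TopologicalSpace A] (𝔄 : Set (Config A D))
    (Φ : Config A D → Config A D) (l : Torus D) (f : Config A D → ℂ) : Prop where
  bounded : ∃ C : ℝ, ∀ a ∈ 𝔄, ‖f a‖ ≤ C
  continuousAt : ∀ᶠ a : 𝔄 in residual 𝔄, ContinuousAt (fun x : 𝔄 => f x) a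
  ca_eq : ∀ᶠ a : 𝔄 in residual 𝔄, f (Φ a) = (l.1 : ℂ) * f a
  shift_eq : ∀ z, ∀ᶠ a : 𝔄 in residual 𝔄, f (shift z a) = (spacePow l z : ℂ) * f a
  ne_zero : ¬ ∀ᶠ a : 𝔄 in residual 𝔄, f a = 0

/-- The a.e. spectrum. -/
def aeSpec [TopologicalSpace A] (𝔄 : Set (Config A D)) (Φ : Config A D → Config A D) :
    Set (Torus D) :=
  {l | ∃ f, IsAEEigenfunction 𝔄 Φ l f}

/-- An eigenset: one a.e. eigenfunction `F l` for each `l` in the a.e. spectrum (the values of `F`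
at other `l` are irrelevant). -/
def IsEigenset [TopologicalSpace A] (𝔄 : Set (Config A D)) (Φ : Config A D → Config A D)
    (F : Torus D → Config A D → ℂ) : Prop :=
  ∀ l ∈ aeSpec 𝔄 Φ, IsAEEigenfunction 𝔄 Φ l (F l)

/-! ### Regular points, good points, values on fragments -/

/-- The (largest) invariant set of points of `𝔄` on which all the functions of the eigenset satisfy
`f ∘ Φ^n ∘ σ^z = λ₀^n λ^z f` exactly. -/
def regularSet [TopologicalSpace A] (𝔄 : Set (Config A D)) (Φ : Config A D → Config A D)
    (F : Torus D → Config A D → ℂ) : Set (Config A D) :=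
  {a | a ∈ 𝔄 ∧ ∀ l ∈ aeSpec 𝔄 Φ, ∀ (n : ℕ) (z : Fin D → ℤ),
    F l (Φ^[n] (shift z a)) = (l.1 : ℂ) ^ n * (spacePow l z : ℂ) * F l a}

/-- Points `w ∈ 𝔄` whose `r`-block at the origin determines `f` up to `ε`. -/
def determinedSet (𝔄 : Set (Config A D)) (f : Config A D → ℂ) (r : ℕ) (ε : ℝ) :
    Set (Config A D) :=
  {w | w ∈ 𝔄 ∧ ∀ b ∈ 𝔄, EqOn b w (box 0 r) → ‖f b - f w‖ < ε}

/-- Points `a ∈ 𝔄` such that for some box `B(y,r) ⊆ Y` the block `a_{B(y,r)}` determines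
`f ∘ σ^y` up to `ε`. -/
def locatedSet (𝔄 : Set (Config A D)) (f : Config A D → ℂ) (Y : Set (Fin D → ℤ)) (ε : ℝ) :
    Set (Config A D) :=
  {a | a ∈ 𝔄 ∧ ∃ r : ℕ, ∃ y ∈ core Y r, shift y a ∈ determinedSet 𝔄 f r ε}

/-- The `(Φ,σ)`-invariant set of good points for `Y`: regular points such that every element of
their `(Φ,σ)`-orbit has, for every eigenfunction of the eigenset, every `ε > 0` and every interior
`Y(k)`, a box in `Y(k)` whose block determines the eigenfunction up to `ε`. -/
def goodSet [TopologicalSpace A] (𝔄 : Set (Config A D)) (Φ : Config A D → Config A D)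
    (F : Torus D → Config A D → ℂ) (Y : Set (Fin D → ℤ)) : Set (Config A D) :=
  {a | a ∈ regularSet 𝔄 Φ F ∧ ∀ l ∈ aeSpec 𝔄 Φ, ∀ k : ℕ, ∀ ε : ℝ, 0 < ε →
    ∀ (n : ℕ) (z : Fin D → ℤ), Φ^[n] (shift z a) ∈ locatedSet 𝔄 (F l) (core Y k) ε}

/-- The set `Â(Y₁,…,Y_N)`: slightly defective configurations whose restriction to each projective
component of each unflawed set of range `r > 0` extends to a regular point, and whose restriction
to each `Y_n` extends to a good point for `Y_n`. -/
def hatSet [TopologicalSpace A] (𝔄 : Set (Config A D)) (Φ : Config A D → Config A D)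
    (F : Torus D → Config A D → ℂ) {N : ℕ} (Y : Fin N → Set (Fin D → ℤ)) : Set (Config A D) :=
  {a | a ∈ slightlyDefective 𝔄 ∧
    (∀ r : ℕ, 0 < r → ∀ C, IsProjectiveComponent 𝔄 a r C → ∃ b ∈ regularSet 𝔄 Φ F, EqOn b a C) ∧
    ∀ n, ∃ d ∈ goodSet 𝔄 Φ F (Y n), EqOn d a (Y n)}

open Classical in
/-- The value `f_λ(a_Y)`: the value of `f_λ` at a regular point that extends `a_Y`
(`0` if there is none). -/
def fragmentValue [TopologicalSpace A] (𝔄 : Set (Config A D)) (Φ : Config A D → Config A D)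
    (F : Torus D → Config A D → ℂ) (l : Torus D) (Y : Set (Fin D → ℤ)) (a : Config A D) : ℂ :=
  if h : ∃ b ∈ regularSet 𝔄 Φ F, EqOn b a Y then F l h.choose else 0

/-- `δ_{nm}(λ) = f_λ(a_{Y_n}) / f_λ(a_{Y_m})`. -/
def displacement [TopologicalSpace A] (𝔄 : Set (Config A D)) (Φ : Config A D → Config A D)
    (F : Torus D → Config A D → ℂ) {N : ℕ} (Y : Fin N → Set (Fin D → ℤ)) (a : Config A D)
    (n m : Fin N) (l : Torus D) : ℂ :=
  fragmentValue 𝔄 Φ F l (Y n) a / fragmentValue 𝔄 Φ F l (Y m) a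

/-! ### Rational dislocations -/

/-- On `𝔄`, the function `g` is determined by the block on `B(0,r)`. -/
def HasRadius (𝔄 : Set (Config A D)) (g : Config A D → ℂ) (r : ℕ) : Prop :=
  ∀ b ∈ 𝔄, ∀ c ∈ 𝔄, EqOn b c (box 0 r) → g b = g c

open Classical in
/-- For `g` of radius `r` on `𝔄`: the value `g_z(a) = g(a_{B(z,r)})`, meaningful whenever the block
`a_{B(z,r)}` is admissible. -/
def localValue (𝔄 : Set (Config A D)) (g : Config A D → ℂ) (r : ℕ) (z : Fin D → ℤ)
    (a : Config A D) : ℂ :=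
  if h : ∃ b ∈ 𝔄, EqOn b (shift z a) (box 0 r) then g h.choose else 0

/-- The phase gap `γ_{y,z}(λ) = λ^{y-z} g_z(a) / g_y(a)`. -/
def phaseGap (𝔄 : Set (Config A D)) (g : Config A D → ℂ) (r : ℕ) (l : Torus D) (a : Config A D)
    (y z : Fin D → ℤ) : ℂ :=
  (spacePow l (y - z) : ℂ) * localValue 𝔄 g r z a / localValue 𝔄 g r y a

end CADefect

end

open CADefect

/-!
Projective transitivity makes the shift topologically transitive, so a shift-invariant function that
is continuous at the points of a comeager set is a.e. constant. Hence the modulus of an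
a.e. eigenfunction and the quotient of two a.e. eigenfunctions with the same eigenvalue are
a.e. constant.

At a good point for `Y` the value of `f_λ` is pinned down, up to every `ε`, by a block inside `Y`.
It is therefore the limit of `f_λ` along comeager sets at *every* point of `𝔄` that extends `a_Y`,
and a.e. identities between eigenfunctions pass to the values `f_λ(a_Y)`, with constants that do not
depend on `Y`. These constants cancel in `δ_{nm}(λ) = f_λ(a_{Y_n}) / f_λ(a_{Y_m})`. If a single
point of `𝔄` extends both fragments, or a regular point extends `a_C` for a component `C` containing
both interiors, then the two values agree.

For a continuous eigenfunction `g` of radius `r'`, the phase `λ^{-z} g_z(a)` takes the same value at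
adjacent points of `G_{r'+1}(a)`, because one admissible block covers both `r'`-boxes.
-/

namespace CADefect

variable {A : Type*} {D : ℕ}

/-! ### Comeager sets and topologically transitive maps -/

section Residual

variable {X Z : Type*} [TopologicalSpace X] [BaireSpace X] [TopologicalSpace Z]

instance nhds_inf_residual_neBot (x : X) : (𝓝 x ⊓ residual X).NeBot := by
  refine inf_neBot_iff.2 fun {s} hs {t} ht => ?_
  rw [inter_comm]
  exact (dense_of_mem_residual ht).inter_nhds_nonempty hs

instance residual_neBot [Nonempty X] : (residual X).NeBot :=
  (nhds_inf_residual_neBot (Classical.arbitrary X)).mono inf_le_right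

lemma eq_of_tendsto_nhds_inf_residual [T2Space Z] {f g : X → Z} {x : X} {v w : Z}
    (hf : Tendsto f (𝓝 x ⊓ residual X) (𝓝 v)) (hg : Tendsto g (𝓝 x ⊓ residual X) (𝓝 w))
    (hfg : f =ᶠ[residual X] g) : v = w :=
  tendsto_nhds_unique_of_eventuallyEq hf hg (hfg.filter_mono inf_le_right)

lemma exists_eventually_residual_eq_const [Nonempty X] [T2Space Z] {ι : Type*} {T : ι → X → X}
    (hT : ∀ i, Continuous (T i))
    (htrans : ∀ U V : Set X, IsOpen U → IsOpen V → U.Nonempty → V.Nonempty →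
      ∃ i, (U ∩ T i ⁻¹' V).Nonempty)
    {f : X → Z} (hf : ∀ᶠ x in residual X, ContinuousAt f x)
    (hinv : ∀ i, ∀ᶠ x in residual X, f (T i x) = f x) :
    ∃ c, ∀ᶠ x in residual X, f x = c := by
  obtain ⟨x₀, hx₀⟩ := hf.exists
  refine ⟨f x₀, hf.mono fun x hx => ?_⟩
  by_contra hne
  obtain ⟨P, Q, hP, hQ, hxP, hxQ, hPQ⟩ := t2_separation hne
  obtain ⟨U, hUP, hU, hxU⟩ := mem_nhds_iff.1 (hx (hP.mem_nhds hxP))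
  obtain ⟨V, hVQ, hV, hxV⟩ := mem_nhds_iff.1 (hx₀ (hQ.mem_nhds hxQ))
  obtain ⟨i, hUV⟩ := htrans U V hU hV ⟨x, hxU⟩ ⟨x₀, hxV⟩
  obtain ⟨z, ⟨hzU, hzV⟩, hz⟩ := (dense_of_mem_residual (hinv i)).inter_open_nonempty
    (U ∩ T i ⁻¹' V) (hU.inter (hV.preimage (hT i))) hUV
  exact hPQ.ne_of_mem (hUP hzU) (hVQ hzV) hz.symm

end Residual

lemma eventually_nhdsWithin_eq_of_finite_image {X Z : Type*} [TopologicalSpace X]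
    [TopologicalSpace Z] [T1Space Z] {f : X → Z} {s : Set X} {x : X}
    (hf : ContinuousWithinAt f s x) (hfin : (f '' s).Finite) : ∀ᶠ y in 𝓝[s] x, f y = f x := by
  have hopen : (f '' s \ {f x})ᶜ ∈ 𝓝 (f x) :=
    (hfin.subset sdiff_subset).isClosed.isOpen_compl.mem_nhds (by simp)
  filter_upwards [hf hopen, self_mem_nhdsWithin] with y hy hys
  by_contra hne
  exact hy ⟨mem_image_of_mem f hys, hne⟩

/-! ### Boxes, trails and shifts -/

lemma box_eq_closedBall (z : Fin D → ℤ) (r : ℕ) : box z r = Metric.closedBall z r := by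
  ext y
  simp only [box, mem_ofPred_eq, Metric.mem_closedBall, dist_pi_le_iff r.cast_nonneg, Int.dist_eq]
  norm_cast

lemma box_mono (z : Fin D → ℤ) {r s : ℕ} (h : r ≤ s) : box z r ⊆ box z s := by
  simpa only [box_eq_closedBall] using Metric.closedBall_subset_closedBall (Nat.cast_le.2 h)

lemma mem_box_comm {y z : Fin D → ℤ} {r : ℕ} : y ∈ box z r ↔ z ∈ box y r := by
  simp only [box_eq_closedBall, Metric.mem_closedBall_comm]

lemma box_subset_box_add {y z : Fin D → ℤ} {r s : ℕ} (h : y ∈ box z s) :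
    box y r ⊆ box z (r + s) := by
  rw [box_eq_closedBall, Metric.mem_closedBall] at h
  rw [box_eq_closedBall, box_eq_closedBall]
  exact Metric.closedBall_subset_closedBall' (by push_cast; gcongr)

lemma finite_box (z : Fin D → ℤ) (r : ℕ) : (box z r).Finite := by
  rw [box_eq_closedBall]
  exact (isCompact_closedBall z (r : ℝ)).finite_of_discrete

lemma exists_subset_box_of_finite {s : Set (Fin D → ℤ)} (hs : s.Finite) (z : Fin D → ℤ) :
    ∃ r, s ⊆ box z r := by
  obtain ⟨ρ, hρ⟩ := hs.isBounded.subset_closedBall z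
  obtain ⟨r, hr⟩ := exists_nat_ge ρ
  exact ⟨r, hρ.trans (box_eq_closedBall z r ▸ Metric.closedBall_subset_closedBall hr)⟩

lemma exists_mem_box_one_of_mem_box_succ {x y : Fin D → ℤ} {k : ℕ} (h : y ∈ box x (k + 1)) :
    ∃ x' ∈ box x 1, y ∈ box x' k := by
  have hcoord : ∀ i, ∃ t : ℤ, |t - x i| ≤ (1 : ℕ) ∧ |y i - t| ≤ k := fun i => by
    have hi := h i
    refine ⟨max (x i - 1) (min (x i + 1) (y i)), ?_⟩
    rw [abs_le] at hi ⊢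
    rw [abs_le]
    omega
  choose x' hx' hy using hcoord
  exact ⟨x', hx', hy⟩

lemma core_antitone (Y : Set (Fin D → ℤ)) : Antitone (core Y) :=
  fun _ _ h _ hy => ⟨hy.1, (box_mono _ h).trans hy.2⟩

lemma core_subset (Y : Set (Fin D → ℤ)) (r : ℕ) : core Y r ⊆ Y := fun _ hy => hy.1

lemma Adj.symm {x y : Fin D → ℤ} (h : Adj x y) : Adj y x := ⟨h.1.symm, mem_box_comm.1 h.2⟩

section Trails

variable {U V C : Set (Fin D → ℤ)} {x y z : Fin D → ℤ}

lemma TrailIn.mem_right (h : TrailIn U x y) : y ∈ U := by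
  obtain ⟨hx, h⟩ := h
  induction h with
  | refl => exact hx
  | tail _ h _ => exact h.2

lemma TrailIn.mono (hUV : U ⊆ V) (h : TrailIn U x y) : TrailIn V x y :=
  ⟨hUV h.1, Relation.ReflTransGen.mono (fun _ _ hab => ⟨hab.1, hUV hab.2⟩) _ _ h.2⟩

lemma TrailIn.trans (h : TrailIn U x y) (h' : TrailIn U y z) : TrailIn U x z :=
  ⟨h.1, h.2.trans h'.2⟩

lemma TrailIn.symm (h : TrailIn U x y) : TrailIn U y x := by
  obtain ⟨hx, h⟩ := h
  induction h with
  | refl => exact ⟨hx, .refl⟩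
  | tail _ hbc ih => exact TrailIn.trans ⟨hbc.2, .single ⟨hbc.1.symm, ih.1⟩⟩ ih

lemma IsTrailComponent.trailIn (hC : IsTrailComponent U C) (hx : x ∈ C) (hy : y ∈ C) :
    TrailIn U x y := by
  obtain ⟨_, -, rfl⟩ := hC
  exact TrailIn.trans (TrailIn.symm hx) hy

lemma trailIn_univ_of_mem_box {k : ℕ} (h : y ∈ box x k) : TrailIn univ x y := by
  induction k generalizing x with
  | zero =>
    obtain rfl : y = x := by simpa [box_eq_closedBall] using h
    exact ⟨mem_univ _, .refl⟩
  | succ k ih =>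
    obtain ⟨x', hx', hy⟩ := exists_mem_box_one_of_mem_box_succ h
    obtain rfl | hne := eq_or_ne x x'
    · exact ih hy
    · exact TrailIn.trans ⟨mem_univ _, .single ⟨⟨hne, hx'⟩, mem_univ _⟩⟩ (ih hy)

end Trails

lemma spacious_univ : Spacious (univ : Set (Fin D → ℤ)) := by
  refine ⟨fun x _ y _ => ?_, fun r => ⟨0, mem_univ _, subset_univ _⟩⟩
  obtain ⟨k, hk⟩ := exists_subset_box_of_finite (finite_singleton y) x
  exact trailIn_univ_of_mem_box (hk rfl)

lemma shift_zero (a : Config A D) : shift 0 a = a := by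
  funext z
  simp [shift]

lemma shift_shift (v w : Fin D → ℤ) (a : Config A D) : shift v (shift w a) = shift (v + w) a := by
  funext z
  simp [shift, add_assoc]

lemma eqOn_shift_box_zero {a b : Config A D} {y : Fin D → ℤ} {r : ℕ} :
    EqOn (shift y b) (shift y a) (box 0 r) ↔ EqOn b a (box y r) := by
  constructor
  · intro h x hx
    have := @h (x - y) fun i => by simpa using hx i
    simpa [shift] using this
  · intro h x hx
    exact h fun i => by simpa using hx i

/-! ### Unflawed sets and their projective components -/

section Unflawed

variable {𝔄 : Set (Config A D)} {a d : Config A D} {Y Y' C C' : Set (Fin D → ℤ)} {z : Fin D → ℤ}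
  {r s : ℕ}

lemma Admissible.mono (h : Admissible 𝔄 a z s) (hrs : r ≤ s) : Admissible 𝔄 a z r := by
  obtain ⟨b, hb, hba⟩ := h
  exact ⟨b, hb, hba.mono (box_mono z hrs)⟩

lemma Admissible.mem_unflawed (h : Admissible 𝔄 a z r) : z ∈ unflawed 𝔄 a r :=
  le_iSup₂ (f := fun (s : ℕ) (_ : Admissible 𝔄 a z s) => (s : ℕ∞)) r h

lemma admissible_of_mem_unflawed (hr : 0 < r) (h : z ∈ unflawed 𝔄 a r) : Admissible 𝔄 a z r := by
  have hlt : ((r - 1 : ℕ) : ℕ∞) < defectField 𝔄 a z :=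
    lt_of_lt_of_le (Nat.cast_lt.2 (Nat.sub_one_lt_of_lt hr)) h
  simp only [defectField, lt_iSup_iff, Nat.cast_lt] at hlt
  obtain ⟨s, hs, hrs⟩ := hlt
  exact hs.mono (by omega)

lemma unflawed_antitone (𝔄 : Set (Config A D)) (a : Config A D) : Antitone (unflawed 𝔄 a) :=
  fun _ _ h _ hz => le_trans (Nat.cast_le.2 h) (show _ ≤ defectField 𝔄 a _ from hz)

lemma core_subset_unflawed (hd : d ∈ 𝔄) (hda : EqOn d a Y) (r : ℕ) :
    core Y r ⊆ unflawed 𝔄 a r :=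
  fun _ hy => Admissible.mem_unflawed ⟨d, hd, hda.mono hy.2⟩

lemma nonempty_of_mem_slightlyDefective (h : a ∈ slightlyDefective 𝔄) : 𝔄.Nonempty := by
  rw [nonempty_iff_ne_empty]
  rintro rfl
  simp [slightlyDefective, defectField, Admissible] at h

lemma IsProjectiveComponent.exists_superset (h : IsProjectiveComponent 𝔄 a s C) (hrs : r ≤ s) :
    ∃ C', IsProjectiveComponent 𝔄 a r C' ∧ C ⊆ C' := by
  obtain ⟨⟨x, hx, rfl⟩, hfar⟩ := h
  have hsub : {y | TrailIn (unflawed 𝔄 a s) x y} ⊆ {y | TrailIn (unflawed 𝔄 a r) x y} :=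
    fun y hy => hy.mono (unflawed_antitone 𝔄 a hrs)
  refine ⟨_, ⟨⟨x, unflawed_antitone 𝔄 a hrs hx, rfl⟩, fun R _ => ?_⟩, hsub⟩
  obtain ⟨y, hy, hyR⟩ := hfar (max s R) (le_max_left _ _)
  exact ⟨y, hsub hy, unflawed_antitone 𝔄 a (le_max_right _ _) hyR⟩

lemma liesInProjectiveComponent_of_trailConnected_core (hY : ∀ k, (core Y k).Nonempty)
    (hd : d ∈ 𝔄) (hda : EqOn d a Y) {R : ℕ} (hR : 0 < R) (hconn : TrailConnected (core Y R)) :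
    LiesInProjectiveComponent 𝔄 a Y := by
  obtain ⟨x, hx⟩ := hY R
  have hsub : core Y R ⊆ {y | TrailIn (unflawed 𝔄 a R) x y} :=
    fun y hy => (hconn x hx y hy).mono (core_subset_unflawed hd hda R)
  refine ⟨R, hR, R, _, ⟨⟨x, core_subset_unflawed hd hda R hx, rfl⟩, fun R' hR' => ?_⟩, hsub⟩
  obtain ⟨y, hy⟩ := hY R'
  exact ⟨y, hsub (core_antitone Y hR' hy), core_subset_unflawed hd hda R' hy⟩

lemma ProjectiveDomainBoundaryBetween.hasProjectiveDomainBoundary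
    (h : ProjectiveDomainBoundaryBetween 𝔄 a Y Y') : HasProjectiveDomainBoundary 𝔄 a := by
  obtain ⟨r, -, -, C, C', hC, hC', hne, -⟩ := h
  exact ⟨r, C, C', hC, hC', hne⟩

lemma LiesInProjectiveComponent.projectiveDomainBoundaryBetween
    (hY : LiesInProjectiveComponent 𝔄 a Y) (hY' : LiesInProjectiveComponent 𝔄 a Y')
    (hsep : ∀ r, 0 < r → ∀ R C, IsProjectiveComponent 𝔄 a r C →
      ¬ (core Y R ⊆ C ∧ core Y' R ⊆ C)) :
    ProjectiveDomainBoundaryBetween 𝔄 a Y Y' := by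
  obtain ⟨r₁, hr₁, R₁, C₁, hC₁, hY⟩ := hY
  obtain ⟨r₂, hr₂, R₂, C₂, hC₂, hY'⟩ := hY'
  obtain ⟨C, hC, hCC⟩ := hC₁.exists_superset (min_le_left r₁ r₂)
  obtain ⟨C', hC', hCC'⟩ := hC₂.exists_superset (min_le_right r₁ r₂)
  have hYC : core Y (max R₁ R₂) ⊆ C := ((core_antitone Y (le_max_left _ _)).trans hY).trans hCC
  have hYC' : core Y' (max R₁ R₂) ⊆ C' :=
    ((core_antitone Y' (le_max_right _ _)).trans hY').trans hCC'
  have hr : 0 < min r₁ r₂ := lt_min hr₁ hr₂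
  refine ⟨_, hr, _, C, C', hC, hC', ?_, hYC, hYC'⟩
  rintro rfl
  exact hsep _ hr _ C hC ⟨hYC, hYC'⟩

end Unflawed

/-! ### Subshifts and invariant functions -/

section Subshift

variable [TopologicalSpace A] {𝔄 : Set (Config A D)}

lemma continuous_shift (v : Fin D → ℤ) : Continuous (shift v : Config A D → Config A D) :=
  continuous_pi fun z => continuous_apply (z + v)

lemma IsSubshift.mapsTo_shift (h : IsSubshift 𝔄) (v : Fin D → ℤ) : MapsTo (shift v) 𝔄 𝔄 :=
  fun _ ha => (h.2 v).subset (mem_image_of_mem _ ha)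

lemma IsSubshift.baireSpace [DiscreteTopology A] (h : IsSubshift 𝔄) : BaireSpace 𝔄 :=
  have : TopologicalSpace.IsCompletelyMetrizableSpace 𝔄 := h.1.isCompletelyMetrizableSpace
  inferInstance

lemma isOpen_setOf_eqOn_box [DiscreteTopology A] (d : Config A D) (y : Fin D → ℤ) (r : ℕ) :
    IsOpen {b : Config A D | EqOn b d (box y r)} :=
  isOpen_set_pi (finite_box y r) fun z _ => isOpen_discrete {d z}

lemma exists_box_subset_of_mem_nhds {a : Config A D} {U : Set (Config A D)} (hU : U ∈ 𝓝 a) :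
    ∃ r, {b | EqOn b a (box 0 r)} ⊆ U := by
  obtain ⟨V, hVU, hV, haV⟩ := mem_nhds_iff.1 hU
  obtain ⟨I, u, hu, hIV⟩ := isOpen_pi_iff.1 hV a haV
  obtain ⟨r, hr⟩ := exists_subset_box_of_finite I.finite_toSet 0
  refine ⟨r, fun b hb => hVU (hIV fun z hz => ?_)⟩
  rw [hb (hr hz)]
  exact (hu z hz).2

lemma exists_hasRadius_of_eventually_eq [DiscreteTopology A] (hcpt : IsCompact 𝔄)
    {g : Config A D → ℂ} (hg : ∀ a ∈ 𝔄, ∀ᶠ b in 𝓝[𝔄] a, g b = g a) : ∃ r, HasRadius 𝔄 g r := by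
  refine hcpt.induction_on (p := fun s => ∃ r, ∀ b ∈ s, ∀ c ∈ 𝔄, EqOn b c (box 0 r) → g b = g c)
    ⟨0, by simp⟩ (fun s t hst ⟨r, hr⟩ => ⟨r, fun b hb => hr b (hst hb)⟩) ?_ fun a ha => ?_
  · rintro s t ⟨r, hr⟩ ⟨r', hr'⟩
    refine ⟨max r r', ?_⟩
    rintro b (hb | hb) c hc hbc
    · exact hr b hb c hc (hbc.mono (box_mono 0 (le_max_left r r')))
    · exact hr' b hb c hc (hbc.mono (box_mono 0 (le_max_right r r')))
  · obtain ⟨r, hr⟩ := exists_box_subset_of_mem_nhds (mem_nhdsWithin_iff_eventually.1 (hg a ha))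
    refine ⟨𝔄 ∩ {b | EqOn b a (box 0 r)}, inter_mem_nhdsWithin 𝔄
      ((isOpen_setOf_eqOn_box a 0 r).mem_nhds (eqOn_refl _ _)), r, ?_⟩
    rintro b ⟨hb, hba⟩ c hc hbc
    rw [hr hba hb, hr (hbc.symm.trans hba) hc]

/-- Topological transitivity of the shift action on `𝔄`: any two nonempty relatively open sets are
joined by a shift. -/
def TopologicallyTransitive (𝔄 : Set (Config A D)) : Prop :=
  ∀ U V : Set (Config A D), IsOpen U → IsOpen V → (𝔄 ∩ U).Nonempty → (𝔄 ∩ V).Nonempty →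
    ∃ z, (𝔄 ∩ U ∩ shift z ⁻¹' V).Nonempty

lemma ProjectivelyTransitive.topologicallyTransitive (h : ProjectivelyTransitive 𝔄)
    (h𝔄 : IsSubshift 𝔄) : TopologicallyTransitive 𝔄 := by
  rintro U V hU hV ⟨u, hu, huU⟩ hVne
  obtain ⟨c, hcU, hc⟩ := mem_closure_iff.1 (h univ spacious_univ V hV hVne hu) U hU huU
  simp only [mem_iUnion] at hc
  obtain ⟨y, -, b, ⟨hb, hbV⟩, rfl⟩ := hc
  refine ⟨y, _, ⟨h𝔄.mapsTo_shift (-y) hb, hcU⟩, ?_⟩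
  rwa [mem_preimage, shift_shift, add_neg_cancel, shift_zero]

variable [BaireSpace 𝔄] [Nonempty 𝔄] {Z : Type*} [TopologicalSpace Z] [T2Space Z]
  {f : Config A D → Z}

lemma TopologicallyTransitive.exists_eventually_eq_const (h𝔄 : IsSubshift 𝔄)
    (h : TopologicallyTransitive 𝔄)
    (hf : ∀ᶠ a : 𝔄 in residual 𝔄, ContinuousAt (fun x : 𝔄 => f x) a)
    (hinv : ∀ z, ∀ᶠ a : 𝔄 in residual 𝔄, f (shift z a) = f a) :
    ∃ c, ∀ᶠ a : 𝔄 in residual 𝔄, f a = c := by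
  refine exists_eventually_residual_eq_const
    (T := fun z => (h𝔄.mapsTo_shift z).restrict (shift z) 𝔄 𝔄)
    (fun z => (continuous_shift z).restrict _) ?_ hf hinv
  rintro _ _ ⟨U, hU, rfl⟩ ⟨V, hV, rfl⟩ ⟨u, hu⟩ ⟨v, hv⟩
  obtain ⟨z, b, ⟨hb, hbU⟩, hbV⟩ := h U V hU hV ⟨u, u.2, hu⟩ ⟨v, v.2, hv⟩
  exact ⟨z, ⟨b, hb⟩, hbU, hbV⟩

lemma TopologicallyTransitive.exists_eq_const_of_continuousOn (h𝔄 : IsSubshift 𝔄)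
    (h : TopologicallyTransitive 𝔄) (hf : ContinuousOn f 𝔄)
    (hinv : ∀ z, ∀ a ∈ 𝔄, f (shift z a) = f a) : ∃ c, ∀ a ∈ 𝔄, f a = c := by
  have hcont : Continuous fun x : 𝔄 => f x := continuousOn_iff_continuous_domRestrict.1 hf
  obtain ⟨c, hc⟩ := h.exists_eventually_eq_const h𝔄 (.of_forall fun _ => hcont.continuousAt)
    fun z => .of_forall fun a => hinv z a a.2
  have heq := hcont.ext_on (dense_of_mem_residual hc) continuous_const fun _ hx => hx
  exact ⟨c, fun a ha => congrFun heq ⟨a, ha⟩⟩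

end Subshift

/-! ### The group of eigenvalues -/

section SpacePow

variable (l l' : Torus D) (y z : Fin D → ℤ)

lemma spacePow_sub : spacePow l (y - z) = spacePow l y / spacePow l z := by
  simp only [spacePow, Pi.sub_apply, zpow_sub, Finset.prod_mul_distrib, Finset.prod_inv_distrib,
    div_eq_mul_inv]

lemma spacePow_mul : spacePow (l * l') z = spacePow l z * spacePow l' z := by
  simp only [spacePow, Prod.snd_mul, Pi.mul_apply, mul_zpow, Finset.prod_mul_distrib]

lemma spacePow_one : spacePow (1 : Torus D) z = 1 := by
  simp only [spacePow, Prod.snd_one, Pi.one_apply, one_zpow, Finset.prod_const_one]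

lemma spacePow_inv : spacePow l⁻¹ z = (spacePow l z)⁻¹ := by
  simp only [spacePow, Prod.snd_inv, Pi.inv_apply, inv_zpow, Finset.prod_inv_distrib]

lemma spacePow_pow (q : ℕ) : spacePow (l ^ q) z = spacePow l z ^ q := by
  induction q with
  | zero => rw [pow_zero, pow_zero, spacePow_one]
  | succ q ih => rw [pow_succ, pow_succ, spacePow_mul, ih]

end SpacePow

section Spectrum

variable [TopologicalSpace A] {𝔄 : Set (Config A D)} {Φ : Config A D → Config A D}
  {l l' : Torus D} {f g : Config A D → ℂ}

lemma IsAEEigenfunction.exists_norm_eq [BaireSpace 𝔄] [Nonempty 𝔄] (h𝔄 : IsSubshift 𝔄)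
    (h : TopologicallyTransitive 𝔄) (hf : IsAEEigenfunction 𝔄 Φ l f) :
    ∃ c, 0 < c ∧ ∀ᶠ a : 𝔄 in residual 𝔄, ‖f a‖ = c := by
  obtain ⟨c, hc⟩ := h.exists_eventually_eq_const h𝔄 (f := fun a => ‖f a‖)
    (hf.continuousAt.mono fun _ ha => ha.norm)
    fun z => (hf.shift_eq z).mono fun a ha => by rw [ha, norm_mul, Circle.norm_coe, one_mul]
  obtain ⟨a, ha⟩ := hc.exists
  refine ⟨c, lt_of_le_of_ne (ha ▸ norm_nonneg _) ?_, hc⟩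
  rintro rfl
  exact hf.ne_zero (hc.mono fun _ ha => norm_eq_zero.1 ha)

lemma IsAEEigenfunction.eventually_ne_zero [BaireSpace 𝔄] [Nonempty 𝔄] (h𝔄 : IsSubshift 𝔄)
    (h : TopologicallyTransitive 𝔄) (hf : IsAEEigenfunction 𝔄 Φ l f) :
    ∀ᶠ a : 𝔄 in residual 𝔄, f a ≠ 0 := by
  obtain ⟨c, hc, hfc⟩ := hf.exists_norm_eq h𝔄 h
  exact hfc.mono fun a ha => norm_pos_iff.1 (ha ▸ hc)

lemma isAEEigenfunction_one [BaireSpace 𝔄] [Nonempty 𝔄] :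
    IsAEEigenfunction 𝔄 Φ 1 fun _ => 1 where
  bounded := ⟨1, fun _ _ => norm_one.le⟩
  continuousAt := .of_forall fun _ => continuousAt_const
  ca_eq := .of_forall fun _ => by rw [Prod.fst_one, Circle.coe_one, one_mul]
  shift_eq z := .of_forall fun _ => by rw [spacePow_one, Circle.coe_one, one_mul]
  ne_zero h := one_ne_zero h.exists.choose_spec

lemma IsAEEigenfunction.conj (hf : IsAEEigenfunction 𝔄 Φ l f) :
    IsAEEigenfunction 𝔄 Φ l⁻¹ fun a => star (f a) where
  bounded := by simpa only [norm_star] using hf.bounded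
  continuousAt := hf.continuousAt.mono fun _ ha => ha.star
  ca_eq := hf.ca_eq.mono fun a ha => by
    rw [ha, star_mul', Prod.fst_inv, Circle.coe_inv_eq_conj, starRingEnd_apply]
  shift_eq z := (hf.shift_eq z).mono fun a ha => by
    rw [ha, star_mul', spacePow_inv, Circle.coe_inv_eq_conj, starRingEnd_apply]
  ne_zero h0 := hf.ne_zero (h0.mono fun _ ha => star_eq_zero.1 ha)

lemma IsAEEigenfunction.mul [BaireSpace 𝔄] [Nonempty 𝔄] (h𝔄 : IsSubshift 𝔄)
    (h : TopologicallyTransitive 𝔄) (hf : IsAEEigenfunction 𝔄 Φ l f)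
    (hg : IsAEEigenfunction 𝔄 Φ l' g) :
    IsAEEigenfunction 𝔄 Φ (l * l') fun a => f a * g a where
  bounded := by
    obtain ⟨C, hC⟩ := hf.bounded
    obtain ⟨C', hC'⟩ := hg.bounded
    exact ⟨C * C', fun a ha => norm_mul_le_of_le (hC a ha) (hC' a ha)⟩
  continuousAt := (hf.continuousAt.and hg.continuousAt).mono fun _ ha => ha.1.mul ha.2
  ca_eq := (hf.ca_eq.and hg.ca_eq).mono fun a ha => by
    rw [ha.1, ha.2, Prod.fst_mul, Circle.coe_mul, mul_mul_mul_comm]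
  shift_eq z := ((hf.shift_eq z).and (hg.shift_eq z)).mono fun a ha => by
    rw [ha.1, ha.2, spacePow_mul, Circle.coe_mul, mul_mul_mul_comm]
  ne_zero h0 := by
    obtain ⟨a, ha, hfa, hga⟩ :=
      (h0.and ((hf.eventually_ne_zero h𝔄 h).and (hg.eventually_ne_zero h𝔄 h))).exists
    exact mul_ne_zero hfa hga ha

/-- The a.e. spectrum as a subgroup of `𝕋^{D+1}`. -/
noncomputable def aeSpecSubgroup [BaireSpace 𝔄] [Nonempty 𝔄] (h𝔄 : IsSubshift 𝔄)
    (h : TopologicallyTransitive 𝔄) (Φ : Config A D → Config A D) : Subgroup (Torus D) where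
  carrier := aeSpec 𝔄 Φ
  one_mem' := ⟨_, isAEEigenfunction_one⟩
  mul_mem' := fun ⟨_, hf⟩ ⟨_, hg⟩ => ⟨_, hf.mul h𝔄 h hg⟩
  inv_mem' := fun ⟨_, hf⟩ => ⟨_, hf.conj⟩

lemma IsAEEigenfunction.exists_eq_const_mul [BaireSpace 𝔄] [Nonempty 𝔄] (h𝔄 : IsSubshift 𝔄)
    (h : TopologicallyTransitive 𝔄) (hf : IsAEEigenfunction 𝔄 Φ l f)
    (hg : IsAEEigenfunction 𝔄 Φ l g) :
    ∃ c ≠ 0, ∀ᶠ a : 𝔄 in residual 𝔄, f a = c * g a := by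
  have hg0 := hg.eventually_ne_zero h𝔄 h
  obtain ⟨c, hc⟩ := h.exists_eventually_eq_const h𝔄 (f := fun a => f a / g a)
    (by filter_upwards [hf.continuousAt, hg.continuousAt, hg0] with a hfa hga ha
        exact hfa.div₀ hga ha)
    fun z => by
      filter_upwards [hf.shift_eq z, hg.shift_eq z] with a hfa hga
      rw [hfa, hga, mul_div_mul_left _ _ (Circle.coe_ne_zero _)]
  have hfg : ∀ᶠ a : 𝔄 in residual 𝔄, f a = c * g a :=
    (hc.and hg0).mono fun a ha => (div_eq_iff ha.2).1 ha.1
  refine ⟨c, ?_, hfg⟩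
  rintro rfl
  exact hf.ne_zero (hfg.mono fun a ha => by rw [ha, zero_mul])

end Spectrum

/-! ### Values on fragments -/

section Fragments

variable [TopologicalSpace A] {𝔄 : Set (Config A D)} {Φ : Config A D → Config A D}
  {F F' : Torus D → Config A D → ℂ} {l l' : Torus D} {Y : Set (Fin D → ℤ)} {a b d : Config A D}

lemma map_shift_of_mem_regularSet (hb : b ∈ regularSet 𝔄 Φ F) (hl : l ∈ aeSpec 𝔄 Φ)
    (z : Fin D → ℤ) : F l (shift z b) = spacePow l z * F l b := by
  simpa using hb.2 l hl 0 z

lemma norm_spacePow_mul_sub (l : Torus D) (z : Fin D → ℤ) (v w : ℂ) :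
    ‖spacePow l z * v - spacePow l z * w‖ = ‖v - w‖ := by
  rw [← mul_sub, norm_mul, Circle.norm_coe, one_mul]

lemma exists_box_of_mem_goodSet (h𝔄 : IsSubshift 𝔄) (hd : d ∈ goodSet 𝔄 Φ F Y)
    (hl : l ∈ aeSpec 𝔄 Φ) (k : ℕ) {ε : ℝ} (hε : 0 < ε) :
    ∃ r y, box y r ⊆ core Y k ∧ ∀ b ∈ 𝔄, EqOn b d (box y r) →
      ‖F l (shift y b) - spacePow l y * F l d‖ < ε := by
  obtain ⟨-, r, y, hy, -, hdet⟩ := hd.2 l hl k ε hε 0 0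
  simp only [Function.iterate_zero, id, shift_zero] at hdet
  refine ⟨r, y, hy.2, fun b hb hbd => ?_⟩
  rw [← map_shift_of_mem_regularSet hd.1 hl]
  exact hdet _ (h𝔄.mapsTo_shift y hb) (eqOn_shift_box_zero.2 hbd)

lemma eq_of_mem_goodSet_of_eqOn_core (h𝔄 : IsSubshift 𝔄) (hd : d ∈ goodSet 𝔄 Φ F Y)
    (hb : b ∈ regularSet 𝔄 Φ F) (hl : l ∈ aeSpec 𝔄 Φ) {k : ℕ} (hbd : EqOn b d (core Y k)) :
    F l b = F l d := by
  refine eq_of_norm_sub_le_zero (le_of_forall_gt_imp_ge_of_dense fun ε hε => ?_)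
  obtain ⟨r, y, hy, h⟩ := exists_box_of_mem_goodSet h𝔄 hd hl k hε
  have hlt := h b hb.1 (hbd.mono hy)
  rw [map_shift_of_mem_regularSet hb hl, norm_spacePow_mul_sub] at hlt
  exact hlt.le

lemma tendsto_of_mem_goodSet [DiscreteTopology A] (h𝔄 : IsSubshift 𝔄)
    (hd : d ∈ goodSet 𝔄 Φ F Y) (hf : IsAEEigenfunction 𝔄 Φ l (F l)) {x : 𝔄}
    (hx : EqOn (x : Config A D) d Y) :
    Tendsto (fun b : 𝔄 => F l b) (𝓝 x ⊓ residual 𝔄) (𝓝 (F l d)) := by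
  refine Metric.tendsto_nhds.2 fun ε hε => ?_
  obtain ⟨r, y, hy, h⟩ := exists_box_of_mem_goodSet h𝔄 hd ⟨_, hf⟩ 0 hε
  have hnear : ∀ᶠ b : 𝔄 in 𝓝 x, EqOn (b : Config A D) d (box y r) :=
    ((isOpen_setOf_eqOn_box d y r).preimage continuous_subtype_val).mem_nhds
      (hx.mono (hy.trans (core_subset Y 0)))
  filter_upwards [hnear.filter_mono inf_le_left, (hf.shift_eq y).filter_mono inf_le_right]
    with b hb hs
  have hlt := h b b.2 hb
  rwa [hs, norm_spacePow_mul_sub, ← dist_eq_norm] at hlt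

/-- `a_Y` extends to a good point for `Y`, so that `f_λ(a_Y)` is well defined. -/
def HasGoodExtension (𝔄 : Set (Config A D)) (Φ : Config A D → Config A D)
    (F : Torus D → Config A D → ℂ) (Y : Set (Fin D → ℤ)) (a : Config A D) : Prop :=
  ∃ d ∈ goodSet 𝔄 Φ F Y, EqOn d a Y

namespace HasGoodExtension

lemma exists_mem (ha : HasGoodExtension 𝔄 Φ F Y a) : ∃ x : 𝔄, EqOn (x : Config A D) a Y := by
  obtain ⟨d, hd, hda⟩ := ha
  exact ⟨⟨d, hd.1.1⟩, hda⟩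

lemma core_nonempty [BaireSpace 𝔄] [Nonempty 𝔄] (ha : HasGoodExtension 𝔄 Φ F Y a) (k : ℕ) :
    (core Y k).Nonempty := by
  obtain ⟨d, hd, -⟩ := ha
  obtain ⟨-, r, y, hy, -⟩ := hd.2 1 ⟨_, isAEEigenfunction_one⟩ k 1 one_pos 0 0
  exact ⟨y, hy.1⟩

lemma apply_eq_fragmentValue (h𝔄 : IsSubshift 𝔄) (ha : HasGoodExtension 𝔄 Φ F Y a)
    (hl : l ∈ aeSpec 𝔄 Φ) (hb : b ∈ regularSet 𝔄 Φ F) {k : ℕ} (hba : EqOn b a (core Y k)) :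
    F l b = fragmentValue 𝔄 Φ F l Y a := by
  obtain ⟨d, hd, hda⟩ := ha
  have heq : ∀ c ∈ regularSet 𝔄 Φ F, ∀ k, EqOn c a (core Y k) → F l c = F l d :=
    fun c hc k hca => eq_of_mem_goodSet_of_eqOn_core h𝔄 hd hc hl
      (hca.trans (hda.symm.mono (core_subset Y k)))
  have hex : ∃ c ∈ regularSet 𝔄 Φ F, EqOn c a Y := ⟨d, hd.1, hda⟩
  rw [fragmentValue, dif_pos hex, heq b hb k hba]
  exact (heq _ hex.choose_spec.1 0 (hex.choose_spec.2.mono (core_subset Y 0))).symm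

variable [DiscreteTopology A]

lemma tendsto_fragmentValue (h𝔄 : IsSubshift 𝔄) (ha : HasGoodExtension 𝔄 Φ F Y a)
    (hf : IsAEEigenfunction 𝔄 Φ l (F l)) {x : 𝔄} (hx : EqOn (x : Config A D) a Y) :
    Tendsto (fun b : 𝔄 => F l b) (𝓝 x ⊓ residual 𝔄) (𝓝 (fragmentValue 𝔄 Φ F l Y a)) := by
  obtain ⟨d, hd, hda⟩ := id ha
  rw [← ha.apply_eq_fragmentValue h𝔄 ⟨_, hf⟩ hd.1 (hda.mono (core_subset Y 0))]
  exact tendsto_of_mem_goodSet h𝔄 hd hf (hx.trans hda.symm)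

variable [BaireSpace 𝔄]

lemma norm_fragmentValue (h𝔄 : IsSubshift 𝔄) (ha : HasGoodExtension 𝔄 Φ F Y a)
    (hf : IsAEEigenfunction 𝔄 Φ l (F l)) {c : ℝ}
    (hc : ∀ᶠ b : 𝔄 in residual 𝔄, ‖F l b‖ = c) : ‖fragmentValue 𝔄 Φ F l Y a‖ = c := by
  obtain ⟨x, hx⟩ := ha.exists_mem
  exact eq_of_tendsto_nhds_inf_residual (ha.tendsto_fragmentValue h𝔄 hf hx).norm
    tendsto_const_nhds hc

lemma fragmentValue_ne_zero [Nonempty 𝔄] (h𝔄 : IsSubshift 𝔄) (h : TopologicallyTransitive 𝔄)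
    (ha : HasGoodExtension 𝔄 Φ F Y a) (hf : IsAEEigenfunction 𝔄 Φ l (F l)) :
    fragmentValue 𝔄 Φ F l Y a ≠ 0 := by
  obtain ⟨c, hc, hfc⟩ := hf.exists_norm_eq h𝔄 h
  exact norm_pos_iff.1 ((ha.norm_fragmentValue h𝔄 hf hfc).symm ▸ hc)

lemma fragmentValue_eq_const_mul (h𝔄 : IsSubshift 𝔄) (ha : HasGoodExtension 𝔄 Φ F Y a)
    (ha' : HasGoodExtension 𝔄 Φ F' Y a) (hf : IsAEEigenfunction 𝔄 Φ l (F l))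
    (hf' : IsAEEigenfunction 𝔄 Φ l' (F' l')) {c : ℂ}
    (hc : ∀ᶠ b : 𝔄 in residual 𝔄, F l b = c * F' l' b) :
    fragmentValue 𝔄 Φ F l Y a = c * fragmentValue 𝔄 Φ F' l' Y a := by
  obtain ⟨x, hx⟩ := ha.exists_mem
  exact eq_of_tendsto_nhds_inf_residual (ha.tendsto_fragmentValue h𝔄 hf hx)
    ((ha'.tendsto_fragmentValue h𝔄 hf' hx).const_mul c) hc

lemma fragmentValue_mul (h𝔄 : IsSubshift 𝔄) (ha : HasGoodExtension 𝔄 Φ F Y a)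
    (hf : IsAEEigenfunction 𝔄 Φ l (F l)) (hf' : IsAEEigenfunction 𝔄 Φ l' (F l'))
    (hff' : IsAEEigenfunction 𝔄 Φ (l * l') (F (l * l'))) {c : ℂ}
    (hc : ∀ᶠ b : 𝔄 in residual 𝔄, F (l * l') b = c * (F l b * F l' b)) :
    fragmentValue 𝔄 Φ F (l * l') Y a =
      c * (fragmentValue 𝔄 Φ F l Y a * fragmentValue 𝔄 Φ F l' Y a) := by
  obtain ⟨x, hx⟩ := ha.exists_mem
  exact eq_of_tendsto_nhds_inf_residual (ha.tendsto_fragmentValue h𝔄 hff' hx)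
    (((ha.tendsto_fragmentValue h𝔄 hf hx).mul (ha.tendsto_fragmentValue h𝔄 hf' hx)).const_mul c)
    hc

lemma apply_eq_const_mul_fragmentValue (h𝔄 : IsSubshift 𝔄) (ha : HasGoodExtension 𝔄 Φ F Y a)
    (hf : IsAEEigenfunction 𝔄 Φ l (F l)) {g : Config A D → ℂ} (hg : ContinuousOn g 𝔄) {c : ℂ}
    (hc : ∀ᶠ x : 𝔄 in residual 𝔄, g x = c * F l x) (hb : b ∈ 𝔄) (hba : EqOn b a Y) :
    g b = c * fragmentValue 𝔄 Φ F l Y a := by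
  have hgb : Tendsto (fun x : 𝔄 => g x) (𝓝 ⟨b, hb⟩) (𝓝 (g b)) :=
    (continuousOn_iff_continuous_domRestrict.1 hg).tendsto ⟨b, hb⟩
  exact eq_of_tendsto_nhds_inf_residual (hgb.mono_left inf_le_left)
    ((ha.tendsto_fragmentValue h𝔄 hf hba).const_mul c) hc

end HasGoodExtension

end Fragments

/-! ### Displacements -/

section Displacement

variable [TopologicalSpace A] [DiscreteTopology A] {𝔄 : Set (Config A D)} [BaireSpace 𝔄]
  [Nonempty 𝔄] {Φ : Config A D → Config A D} {F F' : Torus D → Config A D → ℂ} {l l' : Torus D}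
  {N : ℕ} {Y : Fin N → Set (Fin D → ℤ)} {a b : Config A D} {n m k : Fin N}

lemma norm_displacement (h𝔄 : IsSubshift 𝔄) (h : TopologicallyTransitive 𝔄)
    (hn : HasGoodExtension 𝔄 Φ F (Y n) a) (hm : HasGoodExtension 𝔄 Φ F (Y m) a)
    (hf : IsAEEigenfunction 𝔄 Φ l (F l)) : ‖displacement 𝔄 Φ F Y a n m l‖ = 1 := by
  obtain ⟨c, hc, hfc⟩ := hf.exists_norm_eq h𝔄 h
  rw [displacement, norm_div, hn.norm_fragmentValue h𝔄 hf hfc, hm.norm_fragmentValue h𝔄 hf hfc,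
    div_self hc.ne']

lemma displacement_eq_of_isEigenset (h𝔄 : IsSubshift 𝔄) (h : TopologicallyTransitive 𝔄)
    (hF : IsEigenset 𝔄 Φ F) (hF' : IsEigenset 𝔄 Φ F')
    (ha : ∀ n, HasGoodExtension 𝔄 Φ F (Y n) a) (ha' : ∀ n, HasGoodExtension 𝔄 Φ F' (Y n) a)
    (hl : l ∈ aeSpec 𝔄 Φ) (n m : Fin N) :
    displacement 𝔄 Φ F Y a n m l = displacement 𝔄 Φ F' Y a n m l := by
  obtain ⟨c, hc, hfc⟩ := (hF l hl).exists_eq_const_mul h𝔄 h (hF' l hl)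
  have hval : ∀ i, fragmentValue 𝔄 Φ F l (Y i) a = c * fragmentValue 𝔄 Φ F' l (Y i) a :=
    fun i => (ha i).fragmentValue_eq_const_mul h𝔄 (ha' i) (hF l hl) (hF' l hl) hfc
  rw [displacement, displacement, hval, hval, mul_div_mul_left _ _ hc]

lemma displacement_mul (h𝔄 : IsSubshift 𝔄) (h : TopologicallyTransitive 𝔄)
    (hF : IsEigenset 𝔄 Φ F) (ha : ∀ n, HasGoodExtension 𝔄 Φ F (Y n) a)
    (hl : l ∈ aeSpec 𝔄 Φ) (hl' : l' ∈ aeSpec 𝔄 Φ) (n m : Fin N) :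
    displacement 𝔄 Φ F Y a n m (l * l') =
      displacement 𝔄 Φ F Y a n m l * displacement 𝔄 Φ F Y a n m l' := by
  have hll' := (hF l hl).mul h𝔄 h (hF l' hl')
  obtain ⟨c, hc, hfc⟩ := (hF _ ⟨_, hll'⟩).exists_eq_const_mul h𝔄 h hll'
  have hval := fun i =>
    (ha i).fragmentValue_mul h𝔄 (hF l hl) (hF l' hl') (hF _ ⟨_, hll'⟩) hfc
  rw [displacement, hval, hval, mul_div_mul_left _ _ hc, mul_div_mul_comm, displacement,
    displacement]

/-- The displacement `δ_{nm}` as a character of the a.e. spectrum. -/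
noncomputable def displacementHom (h𝔄 : IsSubshift 𝔄) (h : TopologicallyTransitive 𝔄)
    (hF : IsEigenset 𝔄 Φ F) (ha : ∀ n, HasGoodExtension 𝔄 Φ F (Y n) a) (n m : Fin N) :
    aeSpecSubgroup h𝔄 h Φ →* Circle :=
  MonoidHom.mk'
    (fun l => ⟨displacement 𝔄 Φ F Y a n m l,
      mem_sphere_zero_iff_norm.2 (norm_displacement h𝔄 h (ha n) (ha m) (hF l l.2))⟩)
    fun l l' => Circle.ext (displacement_mul h𝔄 h hF ha l.2 l'.2 n m)

lemma displacement_mul_displacement (h𝔄 : IsSubshift 𝔄) (h : TopologicallyTransitive 𝔄)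
    (hm : HasGoodExtension 𝔄 Φ F (Y m) a) (hf : IsAEEigenfunction 𝔄 Φ l (F l)) :
    displacement 𝔄 Φ F Y a n m l * displacement 𝔄 Φ F Y a m k l =
      displacement 𝔄 Φ F Y a n k l :=
  div_mul_div_cancel₀ (hm.fragmentValue_ne_zero h𝔄 h hf)

lemma displacement_eq_one_of_mem (h𝔄 : IsSubshift 𝔄) (h : TopologicallyTransitive 𝔄)
    (hn : HasGoodExtension 𝔄 Φ F (Y n) a) (hm : HasGoodExtension 𝔄 Φ F (Y m) a)
    (hf : IsAEEigenfunction 𝔄 Φ l (F l)) (ha : a ∈ 𝔄) : displacement 𝔄 Φ F Y a n m l = 1 :=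
  (div_eq_one_iff_eq (hm.fragmentValue_ne_zero h𝔄 h hf)).2 <|
    tendsto_nhds_unique (hn.tendsto_fragmentValue h𝔄 hf (x := ⟨a, ha⟩) (eqOn_refl _ _))
      (hm.tendsto_fragmentValue h𝔄 hf (eqOn_refl _ _))

lemma displacement_eq_one_of_core_subset (h𝔄 : IsSubshift 𝔄) (h : TopologicallyTransitive 𝔄)
    (hn : HasGoodExtension 𝔄 Φ F (Y n) a) (hm : HasGoodExtension 𝔄 Φ F (Y m) a)
    (hf : IsAEEigenfunction 𝔄 Φ l (F l)) (hb : b ∈ regularSet 𝔄 Φ F) {C : Set (Fin D → ℤ)}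
    (hba : EqOn b a C) {R R' : ℕ} (hnC : core (Y n) R ⊆ C) (hmC : core (Y m) R' ⊆ C) :
    displacement 𝔄 Φ F Y a n m l = 1 := by
  refine (div_eq_one_iff_eq (hm.fragmentValue_ne_zero h𝔄 h hf)).2 ?_
  rw [← hn.apply_eq_fragmentValue h𝔄 ⟨_, hf⟩ hb (hba.mono hnC),
    ← hm.apply_eq_fragmentValue h𝔄 ⟨_, hf⟩ hb (hba.mono hmC)]

lemma not_core_subset_of_displacement_ne_one (h𝔄 : IsSubshift 𝔄) (h : TopologicallyTransitive 𝔄)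
    (ha : a ∈ hatSet 𝔄 Φ F Y) (hf : IsAEEigenfunction 𝔄 Φ l (F l))
    (hne : displacement 𝔄 Φ F Y a n m l ≠ 1) {r : ℕ} (hr : 0 < r) {C : Set (Fin D → ℤ)}
    (hC : IsProjectiveComponent 𝔄 a r C) (R R' : ℕ) :
    ¬ (core (Y n) R ⊆ C ∧ core (Y m) R' ⊆ C) := by
  rintro ⟨hnC, hmC⟩
  obtain ⟨b, hb, hba⟩ := ha.2.1 r hr C hC
  exact hne (displacement_eq_one_of_core_subset h𝔄 h (ha.2.2 n) (ha.2.2 m) hf hb hba hnC hmC)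

end Displacement

/-! ### Continuous eigenfunctions -/

/-- The phase `λ^{-z} g_z(a)` that an eigenfunction `g` of radius `r` assigns to the block
`a_{B(z,r)}`; the phase gaps of `a` are its quotients. -/
noncomputable def localPhase (𝔄 : Set (Config A D)) (g : Config A D → ℂ) (r : ℕ) (l : Torus D)
    (z : Fin D → ℤ) (a : Config A D) : ℂ :=
  (spacePow l z : ℂ)⁻¹ * localValue 𝔄 g r z a

lemma phaseGap_eq_localPhase_div (𝔄 : Set (Config A D)) (g : Config A D → ℂ) (r : ℕ)
    (l : Torus D) (a : Config A D) (y z : Fin D → ℤ) :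
    phaseGap 𝔄 g r l a y z = localPhase 𝔄 g r l z a / localPhase 𝔄 g r l y a := by
  rw [phaseGap, localPhase, localPhase, spacePow_sub, Circle.coe_div]
  field_simp

section Rational

variable [TopologicalSpace A] {𝔄 : Set (Config A D)} {Φ : Config A D → Config A D}
  {F : Torus D → Config A D → ℂ} {l : Torus D} {g : Config A D → ℂ} {r s : ℕ}
  {a b : Config A D} {y z : Fin D → ℤ}

lemma IsEigenfunction.exists_norm_eq [BaireSpace 𝔄] [Nonempty 𝔄] (h𝔄 : IsSubshift 𝔄)
    (h : TopologicallyTransitive 𝔄) (hg : IsEigenfunction 𝔄 Φ l g) :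
    ∃ c, 0 < c ∧ ∀ a ∈ 𝔄, ‖g a‖ = c := by
  obtain ⟨c, hc⟩ := h.exists_eq_const_of_continuousOn h𝔄 hg.continuousOn.norm
    fun z a ha => by rw [hg.shift_eq z a ha, norm_mul, Circle.norm_coe, one_mul]
  obtain ⟨a, ha, hga⟩ := hg.ne_zero
  exact ⟨c, hc a ha ▸ norm_pos_iff.2 hga, hc⟩

lemma IsEigenfunction.isAEEigenfunction [BaireSpace 𝔄] [Nonempty 𝔄] (h𝔄 : IsSubshift 𝔄)
    (h : TopologicallyTransitive 𝔄) (hg : IsEigenfunction 𝔄 Φ l g) :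
    IsAEEigenfunction 𝔄 Φ l g where
  bounded := by
    obtain ⟨c, -, hc⟩ := hg.exists_norm_eq h𝔄 h
    exact ⟨c, fun a ha => (hc a ha).le⟩
  continuousAt := .of_forall fun _ =>
    (continuousOn_iff_continuous_domRestrict.1 hg.continuousOn).continuousAt
  ca_eq := .of_forall fun a => hg.ca_eq a a.2
  shift_eq z := .of_forall fun a => hg.shift_eq z a a.2
  ne_zero h0 := by
    obtain ⟨c, hc0, hc⟩ := hg.exists_norm_eq h𝔄 h
    obtain ⟨a, ha⟩ := h0.exists
    exact hc0.ne' (by rw [← hc a a.2, ha, norm_zero])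

lemma IsEigenfunction.finite_image [BaireSpace 𝔄] [Nonempty 𝔄] (h𝔄 : IsSubshift 𝔄)
    (h : TopologicallyTransitive 𝔄) (hg : IsEigenfunction 𝔄 Φ l g) (hl : IsOfFinOrder l) :
    (g '' 𝔄).Finite := by
  obtain ⟨q, hq, hlq⟩ := isOfFinOrder_iff_pow_eq_one.1 hl
  obtain ⟨c, hc⟩ := h.exists_eq_const_of_continuousOn h𝔄 (hg.continuousOn.pow q)
    fun z a ha => by
      rw [Pi.pow_apply, Pi.pow_apply, hg.shift_eq z a ha, mul_pow, ← Circle.coe_pow,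
        ← spacePow_pow, hlq, spacePow_one, Circle.coe_one, one_mul]
  refine (Polynomial.nthRoots q c).toFinset.finite_toSet.subset (image_subset_iff.2 fun a ha => ?_)
  simpa [Polynomial.mem_nthRoots hq] using hc a ha

lemma IsEigenfunction.exists_hasRadius [DiscreteTopology A] [BaireSpace 𝔄] [Nonempty 𝔄]
    (h𝔄 : IsSubshift 𝔄) (hcpt : IsCompact 𝔄) (h : TopologicallyTransitive 𝔄)
    (hg : IsEigenfunction 𝔄 Φ l g) (hl : IsOfFinOrder l) : ∃ r, HasRadius 𝔄 g r :=
  exists_hasRadius_of_eventually_eq hcpt fun a ha =>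
    eventually_nhdsWithin_eq_of_finite_image (hg.continuousOn a ha) (hg.finite_image h𝔄 h hl)

lemma IsEigenfunction.localPhase_eq (h𝔄 : IsSubshift 𝔄) (hg : IsEigenfunction 𝔄 Φ l g)
    (hr : HasRadius 𝔄 g r) (hb : b ∈ 𝔄) (hba : EqOn b a (box z r)) :
    localPhase 𝔄 g r l z a = g b := by
  have hba' := eqOn_shift_box_zero.2 hba
  have hex : ∃ c ∈ 𝔄, EqOn c (shift z a) (box 0 r) := ⟨_, h𝔄.mapsTo_shift z hb, hba'⟩
  have hval : localValue 𝔄 g r z a = g (shift z b) := by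
    rw [localValue, dif_pos hex]
    exact hr _ hex.choose_spec.1 _ (h𝔄.mapsTo_shift z hb) (hex.choose_spec.2.trans hba'.symm)
  rw [localPhase, hval, hg.shift_eq z b hb, inv_mul_cancel_left₀ (Circle.coe_ne_zero _)]

lemma IsEigenfunction.localPhase_eq_of_trailIn (h𝔄 : IsSubshift 𝔄)
    (hg : IsEigenfunction 𝔄 Φ l g) (hr : HasRadius 𝔄 g r) (hrs : r + 1 ≤ s)
    (hyz : TrailIn (unflawed 𝔄 a s) y z) :
    localPhase 𝔄 g r l y a = localPhase 𝔄 g r l z a := by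
  obtain ⟨hy, hyz⟩ := hyz
  induction hyz with
  | refl => rfl
  | @tail u v hu huv ih =>
    obtain ⟨b, hb, hba⟩ := admissible_of_mem_unflawed (by omega)
      (TrailIn.mem_right (U := unflawed 𝔄 a s) ⟨hy, hu⟩)
    have hba' : EqOn b a (box u (r + 1)) := hba.mono (box_mono u hrs)
    rw [ih, hg.localPhase_eq h𝔄 hr hb (hba'.mono (box_mono u r.le_succ)),
      hg.localPhase_eq h𝔄 hr hb (hba'.mono (box_subset_box_add huv.1.2))]

variable {N : ℕ} {Y : Fin N → Set (Fin D → ℤ)} {n m : Fin N}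

lemma IsEigenfunction.phaseGap_eq_displacement [DiscreteTopology A] [BaireSpace 𝔄]
    [Nonempty 𝔄] (h𝔄 : IsSubshift 𝔄) (h : TopologicallyTransitive 𝔄)
    (hg : IsEigenfunction 𝔄 Φ l g) (hr : HasRadius 𝔄 g r)
    (hf : IsAEEigenfunction 𝔄 Φ l (F l)) (hn : HasGoodExtension 𝔄 Φ F (Y n) a)
    (hm : HasGoodExtension 𝔄 Φ F (Y m) a) (hy : y ∈ core (Y n) r) (hz : z ∈ core (Y m) r) :
    phaseGap 𝔄 g r l a z y = displacement 𝔄 Φ F Y a n m l := by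
  obtain ⟨c, hc, hgf⟩ := (hg.isAEEigenfunction h𝔄 h).exists_eq_const_mul h𝔄 h hf
  have hphase : ∀ {i x}, HasGoodExtension 𝔄 Φ F (Y i) a → x ∈ core (Y i) r →
      localPhase 𝔄 g r l x a = c * fragmentValue 𝔄 Φ F l (Y i) a := by
    intro i x hi hx
    obtain ⟨b, hba⟩ := hi.exists_mem
    rw [hg.localPhase_eq h𝔄 hr b.2 (hba.mono hx.2),
      hi.apply_eq_const_mul_fragmentValue h𝔄 hf hg.continuousOn hgf b.2 hba]
  rw [phaseGap_eq_localPhase_div, hphase hn hy, hphase hm hz, mul_div_mul_left _ _ hc,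
    displacement]

lemma IsEigenfunction.phaseGap_eq_of_trailIn (h𝔄 : IsSubshift 𝔄) (hg : IsEigenfunction 𝔄 Φ l g)
    (hr : HasRadius 𝔄 g r) (hrs : r + 1 ≤ s) {y' z' : Fin D → ℤ}
    (hy : TrailIn (unflawed 𝔄 a s) y y') (hz : TrailIn (unflawed 𝔄 a s) z z') :
    phaseGap 𝔄 g r l a y z = phaseGap 𝔄 g r l a y' z' := by
  rw [phaseGap_eq_localPhase_div, phaseGap_eq_localPhase_div,
    hg.localPhase_eq_of_trailIn h𝔄 hr hrs hy, hg.localPhase_eq_of_trailIn h𝔄 hr hrs hz]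

lemma IsEigenfunction.phaseGap_eq_displacement_of_isTrailComponent [DiscreteTopology A]
    [BaireSpace 𝔄] [Nonempty 𝔄] (h𝔄 : IsSubshift 𝔄) (h : TopologicallyTransitive 𝔄)
    (hg : IsEigenfunction 𝔄 Φ l g) (hr : HasRadius 𝔄 g r)
    (hf : IsAEEigenfunction 𝔄 Φ l (F l)) (hn : HasGoodExtension 𝔄 Φ F (Y n) a)
    (hm : HasGoodExtension 𝔄 Φ F (Y m) a) (hrs : r + 1 ≤ s) {C C' : Set (Fin D → ℤ)}
    (hC : IsTrailComponent (unflawed 𝔄 a s) C) (hC' : IsTrailComponent (unflawed 𝔄 a s) C')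
    (hCn : (C ∩ core (Y n) r).Nonempty) (hCm : (C' ∩ core (Y m) r).Nonempty)
    (hy : y ∈ C) (hz : z ∈ C') :
    phaseGap 𝔄 g r l a z y = displacement 𝔄 Φ F Y a n m l := by
  obtain ⟨y', hy'C, hy'⟩ := hCn
  obtain ⟨z', hz'C, hz'⟩ := hCm
  rw [hg.phaseGap_eq_of_trailIn h𝔄 hr hrs (hC'.trailIn hz hz'C) (hC.trailIn hy hy'C)]
  exact hg.phaseGap_eq_displacement h𝔄 h hr hf hn hm hy' hz'

end Rational

end CADefect

theorem mainTheorem3_general {A : Type*} [TopologicalSpace A] [DiscreteTopology A] {D : ℕ}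
    (Φ : Config A D → Config A D) (𝔄 : Set (Config A D)) (_hΦ : MapsTo Φ 𝔄 𝔄)
    (h𝔄 : IsSubshift 𝔄) (htrans : TopologicallyTransitive 𝔄)
    (F : Torus D → Config A D → ℂ) (hF : IsEigenset 𝔄 Φ F)
    {N : ℕ} (Y : Fin N → Set (Fin D → ℤ)) (a : Config A D) (ha : a ∈ hatSet 𝔄 Φ F Y) :
    (∀ n, ∀ l ∈ aeSpec 𝔄 Φ, fragmentValue 𝔄 Φ F l (Y n) a ≠ 0 ∧
      ∀ b ∈ regularSet 𝔄 Φ F, EqOn b a (Y n) → F l b = fragmentValue 𝔄 Φ F l (Y n) a) ∧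
    (∀ F' : Torus D → Config A D → ℂ, IsEigenset 𝔄 Φ F' → a ∈ hatSet 𝔄 Φ F' Y →
      ∀ n m, ∀ l ∈ aeSpec 𝔄 Φ, displacement 𝔄 Φ F' Y a n m l = displacement 𝔄 Φ F Y a n m l) ∧
    (∃ S : Subgroup (Torus D), (S : Set (Torus D)) = aeSpec 𝔄 Φ ∧
      ∀ n m, ∃ χ : S →* Circle, ∀ l : S, (χ l : ℂ) = displacement 𝔄 Φ F Y a n m l) ∧
    (∀ n m k, ∀ l ∈ aeSpec 𝔄 Φ, displacement 𝔄 Φ F Y a n k l =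
      displacement 𝔄 Φ F Y a n m l * displacement 𝔄 Φ F Y a m k l) ∧
    (∀ n m, (∃ l ∈ aeSpec 𝔄 Φ, displacement 𝔄 Φ F Y a n m l ≠ 1) →
      a ∉ 𝔄 ∧
      (∀ r : ℕ, 0 < r → ∀ (R : ℕ) (C : Set (Fin D → ℤ)), IsProjectiveComponent 𝔄 a r C →
        ¬ (core (Y n) R ⊆ C ∧ core (Y m) R ⊆ C)) ∧
      (LiesInProjectiveComponent 𝔄 a (Y n) → LiesInProjectiveComponent 𝔄 a (Y m) →
        HasProjectiveDomainBoundary 𝔄 a ∧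
          ProjectiveDomainBoundaryBetween 𝔄 a (Y n) (Y m))) ∧
    (∀ n, (∃ R : ℕ, 0 < R ∧ TrailConnected (core (Y n) R)) →
      LiesInProjectiveComponent 𝔄 a (Y n)) ∧
    (∀ l ∈ ratSpec 𝔄 Φ, l ∈ aeSpec 𝔄 Φ ∧ ∀ g, IsEigenfunction 𝔄 Φ l g →
      (IsCompact 𝔄 → ∃ r' : ℕ, HasRadius 𝔄 g r') ∧
      ∀ r' : ℕ, HasRadius 𝔄 g r' → ∀ n m,
        (∀ y ∈ core (Y n) r', ∀ z ∈ core (Y m) r',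
          phaseGap 𝔄 g r' l a z y = displacement 𝔄 Φ F Y a n m l) ∧
        (∀ r : ℕ, r' + 1 ≤ r → ∀ C C' : Set (Fin D → ℤ),
          IsTrailComponent (unflawed 𝔄 a r) C → IsTrailComponent (unflawed 𝔄 a r) C' →
          (C ∩ core (Y n) r').Nonempty → (C' ∩ core (Y m) r').Nonempty →
          ∀ y ∈ C, ∀ z ∈ C',
            phaseGap 𝔄 g r' l a z y = displacement 𝔄 Φ F Y a n m l)) := by
  have := h𝔄.baireSpace
  have := (nonempty_of_mem_slightlyDefective ha.1).to_subtype
  have hgood : ∀ n, HasGoodExtension 𝔄 Φ F (Y n) a := ha.2.2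
  refine ⟨fun n l hl => ⟨?_, fun b hb hba => ?_⟩, fun F' hF' ha' n m l hl => ?_,
    ⟨aeSpecSubgroup h𝔄 htrans Φ, rfl, fun n m => ?_⟩, fun n m k l hl => ?_,
    fun n m ⟨l, hl, hne⟩ => ?_, fun n ⟨R, hR, hconn⟩ => ?_, fun l ⟨⟨f, hf⟩, hfin⟩ => ?_⟩
  · exact (hgood n).fragmentValue_ne_zero h𝔄 htrans (hF l hl)
  · exact (hgood n).apply_eq_fragmentValue h𝔄 hl hb (hba.mono (core_subset (Y n) 0))
  · exact displacement_eq_of_isEigenset h𝔄 htrans hF' hF ha'.2.2 hgood hl n m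
  · exact ⟨displacementHom h𝔄 htrans hF hgood n m, fun _ => rfl⟩
  · exact (displacement_mul_displacement h𝔄 htrans (hgood m) (hF l hl)).symm
  · have hsep := fun r hr R C hC =>
      not_core_subset_of_displacement_ne_one (r := r) (C := C) h𝔄 htrans ha (hF l hl) hne hr hC R R
    refine ⟨mt (displacement_eq_one_of_mem h𝔄 htrans (hgood n) (hgood m) (hF l hl)) hne, hsep,
      fun hn hm => ?_⟩
    have hbdry := hn.projectiveDomainBoundaryBetween hm hsep
    exact ⟨hbdry.hasProjectiveDomainBoundary, hbdry⟩
  · obtain ⟨x, hx⟩ := (hgood n).exists_mem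
    exact liesInProjectiveComponent_of_trailConnected_core (hgood n).core_nonempty x.2 hx hR hconn
  · have hl : l ∈ aeSpec 𝔄 Φ := ⟨f, hf.isAEEigenfunction h𝔄 htrans⟩
    exact ⟨hl, fun g hg => ⟨fun hcpt => hg.exists_hasRadius h𝔄 hcpt htrans hfin, fun r' hr' n m =>
      ⟨fun y hy z hz => hg.phaseGap_eq_displacement h𝔄 htrans hr' (hF l hl) (hgood n) (hgood m)
        hy hz, fun r hr C C' hC hC' hCn hCm y hy z hz =>
        hg.phaseGap_eq_displacement_of_isTrailComponent h𝔄 htrans hr' (hF l hl) (hgood n)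
          (hgood m) hr hC hC' hCn hCm hy hz⟩⟩⟩

theorem mainTheorem3 {A : Type*} [Finite A] [TopologicalSpace A] [DiscreteTopology A]
    {D : ℕ} (hD : 1 ≤ D)
    (Φ : Config A D → Config A D) (hΦ : IsCA Φ)
    (𝔄 : Set (Config A D)) (h𝔄 : IsSubshift 𝔄) (htrans : ProjectivelyTransitive 𝔄)
    (hinv : Φ '' 𝔄 = 𝔄)
    (F : Torus D → Config A D → ℂ) (hF : IsEigenset 𝔄 Φ F)
    {N : ℕ} (Y : Fin N → Set (Fin D → ℤ)) (hY : ∀ n, Spacious (Y n))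
    (hdisj : Pairwise fun n m => Disjoint (Y n) (Y m))
    (a : Config A D) (ha : a ∈ hatSet 𝔄 Φ F Y) :
    -- `f_λ(a_{Y_n})` is well defined (every regular extension gives the same value) and nonzero
    (∀ n, ∀ l ∈ aeSpec 𝔄 Φ, fragmentValue 𝔄 Φ F l (Y n) a ≠ 0 ∧
      ∀ b ∈ regularSet 𝔄 Φ F, EqOn b a (Y n) → F l b = fragmentValue 𝔄 Φ F l (Y n) a) ∧
    -- (a) `δ_{nm}` does not depend on the choice of the eigenfunctions
    (∀ F' : Torus D → Config A D → ℂ, IsEigenset 𝔄 Φ F' → a ∈ hatSet 𝔄 Φ F' Y →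
      ∀ n m, ∀ l ∈ aeSpec 𝔄 Φ, displacement 𝔄 Φ F' Y a n m l = displacement 𝔄 Φ F Y a n m l) ∧
    -- (b) the a.e. spectrum is a group and `δ_{nm}` is a character of it
    (∃ S : Subgroup (Torus D), (S : Set (Torus D)) = aeSpec 𝔄 Φ ∧
      ∀ n m, ∃ χ : S →* Circle, ∀ l : S, (χ l : ℂ) = displacement 𝔄 Φ F Y a n m l) ∧
    -- (c) cocycle identity
    (∀ n m k, ∀ l ∈ aeSpec 𝔄 Φ, displacement 𝔄 Φ F Y a n k l =
      displacement 𝔄 Φ F Y a n m l * displacement 𝔄 Φ F Y a m k l) ∧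
    -- (d) a nontrivial `δ_{nm}` forces a projective domain boundary between `Y_n` and `Y_m`
    (∀ n m, (∃ l ∈ aeSpec 𝔄 Φ, displacement 𝔄 Φ F Y a n m l ≠ 1) →
      a ∉ 𝔄 ∧
      (∀ r : ℕ, 0 < r → ∀ (R : ℕ) (C : Set (Fin D → ℤ)), IsProjectiveComponent 𝔄 a r C →
        ¬ (core (Y n) R ⊆ C ∧ core (Y m) R ⊆ C)) ∧
      (LiesInProjectiveComponent 𝔄 a (Y n) → LiesInProjectiveComponent 𝔄 a (Y m) →
        HasProjectiveDomainBoundary 𝔄 a ∧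
          ProjectiveDomainBoundaryBetween 𝔄 a (Y n) (Y m))) ∧
    (∀ n, (∃ R : ℕ, 0 < R ∧ TrailConnected (core (Y n) R)) →
      LiesInProjectiveComponent 𝔄 a (Y n)) ∧
    -- (e) at a rational eigenvalue, `δ_{nm}` is the phase gap of the continuous eigenfunctions
    (∀ l ∈ ratSpec 𝔄 Φ, l ∈ aeSpec 𝔄 Φ ∧ ∀ g, IsEigenfunction 𝔄 Φ l g →
      (∃ r' : ℕ, HasRadius 𝔄 g r') ∧
      ∀ r' : ℕ, HasRadius 𝔄 g r' → ∀ n m,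
        (∀ y ∈ core (Y n) r', ∀ z ∈ core (Y m) r',
          phaseGap 𝔄 g r' l a z y = displacement 𝔄 Φ F Y a n m l) ∧
        (∀ r : ℕ, r' + 1 ≤ r → ∀ C C' : Set (Fin D → ℤ),
          IsTrailComponent (unflawed 𝔄 a r) C → IsTrailComponent (unflawed 𝔄 a r) C' →
          (C ∩ core (Y n) r').Nonempty → (C' ∩ core (Y m) r').Nonempty →
          ∀ y ∈ C, ∀ z ∈ C',
            phaseGap 𝔄 g r' l a z y = displacement 𝔄 Φ F Y a n m l)) := by
  simpa only [h𝔄.1.isCompact, true_imp_iff] using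
    mainTheorem3_general Φ 𝔄 (mapsTo_iff_image_subset.2 hinv.subset) h𝔄
      (htrans.topologicallyTransitive h𝔄) F hF Y a ha
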